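/- **Lemma (Mass Conservation in the Limiting Problem).** *Geometry.* Write $\mathbf x=(\widetilde{\mathbf x},z)\in\mathbb R^{N-1}\times\mathbb R$, and let the subscripts $T$, $N$ denote the first $N-1$ components and the last component of a vector. Let $G_0,G\subset\mathbb R^{N-1}$ be bounded domains with $\overline G\subset G_0$, let $\zeta\in C^2(G_0)$, and set $$\Gamma=\{(\widetilde{\mathbf x},\zeta(\widetilde{\mathbf x})):\widetilde{\mathbf x}\in G\},\qquad \Omega_2=\{(\widetilde{\mathbf x},z):\widetilde{\mathbf x}\in G,\ \zeta(\widetilde{\mathbf x})<z<\zeta(\widetilde{\mathbf x})+1\}.$$ Let $\Omega_1\subset\mathbb R^N$ be a bounded domain, disjoint from $\Omega_2$, with $\partial\Omega_1\cap\partial\Omega_2=\overline\Gamma$ and $\Omega_1\cup\Gamma\cup\Omega_2$ open. Let $\Gamma+1$ be the top $\{(\widetilde{\mathbf x},\zeta(\widetilde{\mathbf x})+1):\widetilde{\mathbf x}\in G\}$ of $\Omega_2$, let $\hat{\mathbf n}=(-\nabla_T\zeta,1)/|(-\nabla_T\zeta,1)|$, and let $dS=|(-\nabla_T\zeta,1)|\,d\widetilde{\mathbf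 x}$ be the surface measure of $\Gamma$. *Spaces.* $\mathbf X_2$ is the space of $\mathbf w\in\mathbf H^1(\Omega_2)$ that vanish on the lateral wall of $\Omega_2$ and satisfy $\mathbf w\cdot\hat{\mathbf n}=0$ on $\Gamma+1$; $\mathbf X$ is the space of $[\mathbf w^1,\mathbf w^2]\in\mathbf H_{\rm div}(\Omega_1)\times\mathbf X_2$ with $\mathbf w^1\cdot\hat{\mathbf n}=\mathbf w^2\cdot\hat{\mathbf n}$ on $\Gamma$; $\mathbf Y=L^2(\Omega_1)\times L^2(\Omega_2)$. For $\epsilon>0$ put $\mathbf D^\epsilon\mathbf w=\nabla_T\mathbf w+(1-\frac1\epsilon)\,\partial_z\mathbf w\,\nabla_T\zeta$, and on $\Gamma$ put $\mathbf w(\tau)=\mathbf w-(\mathbf w\cdot\hat{\mathbf n})\hat{\mathbf n}$. *The $\epsilon$-problem.* Let $\mu>0$, $\alpha,\beta\ge 0$ be bounded and let $\mathcal Q$ be a bounded, uniformly elliptic tensor. $[\mathbf v^\epsilon,p^\epsilon]\in\mathbf X\times\mathbf Y$ solves the $\epsilon$-problem with forcing terms $\mathbf f^{2,\epsilon}\in\mathbf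 L^2(\Omega_2)$, $h^{1,\epsilon}\in L^2(\Omega_1)$ if $$\int_{\Omega_1}\mathcal Q\mathbf v^{1,\epsilon}\cdot\mathbf w^1-\int_{\Omega_1}p^{1,\epsilon}\nabla\cdot\mathbf w^1-\epsilon\int_{\Omega_2}p^{2,\epsilon}\nabla_T\cdot\mathbf w^2_T-\epsilon\Big(1-\frac1\epsilon\Big)\int_{\Omega_2}p^{2,\epsilon}\,\partial_z\mathbf w^2_T\cdot\nabla_T\zeta-\int_{\Omega_2}p^{2,\epsilon}\partial_z\mathbf w^2_N$$ $$+\epsilon^2\int_{\Omega_2}\mu\,\mathbf D^\epsilon\mathbf v^{2,\epsilon}:\mathbf D^\epsilon\mathbf w^2+\int_{\Omega_2}\mu\,\partial_z\mathbf v^{2,\epsilon}\cdot\partial_z\mathbf w^2+\int_\Gamma\alpha(\mathbf v^{1,\epsilon}\cdot\hat{\mathbf n})(\mathbf w^1\cdot\hat{\mathbf n})\,dS+\epsilon^2\int_\Gamma\beta\sqrt{\mathcal Q}\,\mathbf v^{2,\epsilon}(\tau)\cdot\mathbf w^2(\tau)\,dS=\epsilon\int_{\Omega_2}\mathbf f^{2,\epsilon}\cdot\mathbf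 w^2,$$ $$\int_{\Omega_1}\nabla\cdot\mathbf v^{1,\epsilon}\varphi^1+\epsilon\int_{\Omega_2}\nabla_T\cdot\mathbf v^{2,\epsilon}_T\,\varphi^2+\epsilon\Big(1-\frac1\epsilon\Big)\int_{\Omega_2}\partial_z\mathbf v^{2,\epsilon}_T\cdot\nabla_T\zeta\,\varphi^2+\int_{\Omega_2}\partial_z\mathbf v^{2,\epsilon}_N\,\varphi^2=\int_{\Omega_1}h^{1,\epsilon}\varphi^1$$ for all $[\mathbf w^1,\mathbf w^2]\in\mathbf X$ and $[\varphi^1,\varphi^2]\in\mathbf Y$. *Limits.* Let $\epsilon\downarrow0$ along a sequence, let $\mathbf f^{2,\epsilon}\rightharpoonup\mathbf f^2$ in $\mathbf L^2(\Omega_2)$ and $h^{1,\epsilon}\rightharpoonup h^1$ in $L^2(\Omega_1)$, let $[\mathbf v^\epsilon,p^\epsilon]$ be solutions of the $\epsilon$-problems, and let $\mathbf v^1\in\mathbf H_{\rm div}(\Omega_1)$, $\boldsymbol\chi\in\mathbf L^2(\Omega_2)$ and $\mathbf v^2\in\mathbf H^1(\Omega_2)$ be limits in the sense that $\mathbf v^{1,\epsilon}\rightharpoonup\mathbf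 v^1$ in $\mathbf H_{\rm div}(\Omega_1)$, $\partial_z\mathbf v^{2,\epsilon}\rightharpoonup\boldsymbol\chi$ in $\mathbf L^2(\Omega_2)$ and $\epsilon\,\mathbf v^{2,\epsilon}\rightharpoonup\mathbf v^2$ in $\mathbf H^1(\Omega_2)$. *Conclusion.* Then $\nabla\cdot\mathbf v^1=h^1$ in $\Omega_1$. Moreover the normal trace $\mathbf v^1\cdot\hat{\mathbf n}$ on $\Gamma$ belongs to $L^2(\Gamma)$, and for every $\varphi^2\in L^2(\Omega_2)$ that is independent of $z$, $$\int_{\Omega_2}\nabla_T\cdot\mathbf v^2_T\,\varphi^2\,d\widetilde{\mathbf x}\,dz-\int_G|(-\nabla_T\zeta,1)|\,(\mathbf v^1\cdot\hat{\mathbf n})\big(\widetilde{\mathbf x},\zeta(\widetilde{\mathbf x})\big)\,\varphi^2(\widetilde{\mathbf x})\,d\widetilde{\mathbf x}=0,$$ that is, $\int_{\Omega_2}\nabla_T\cdot\mathbf v^2_T\,\varphi^2=\int_\Gamma(\mathbf v^1\cdot\hat{\mathbf n})\,\varphi^2\,dS$. -/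

import Mathlib

open MeasureTheory Filter Topology
open scoped ContDiff

noncomputable section

namespace DarcyStokes

/-- The horizontal space `ℝ^{N-1}`, with `d = N - 1`. -/
abbrev Hor (d : ℕ) := EuclideanSpace ℝ (Fin d)

/-- The space `ℝ^N = ℝ^{N-1} × ℝ`; a vector `w` has horizontal part `w.1 = w_T` and last component
`w.2 = w_N`.  The Euclidean structure is the one given by `dot` below. -/
abbrev Pt (d : ℕ) := EuclideanSpace ℝ (Fin d) × ℝ

variable {d : ℕ}

/-- The Euclidean scalar product of `ℝ^N`. -/
def dot (a b : Pt d) : ℝ := inner ℝ a.1 b.1 + a.2 * b.2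

/-- The `i`-th horizontal canonical vector. -/
def dirT (i : Fin d) : Pt d := (EuclideanSpace.single i 1, 0)

/-- The vertical canonical vector. -/
def dirZ : Pt d := (0, 1)

/-! ### Weak derivatives, Sobolev fields and weak convergence -/

/-- Square integrability on a set. -/
def IsL2 {X F : Type*} [MeasureSpace X] [NormedAddCommGroup F] (U : Set X) (u : X → F) : Prop :=
  MemLp u 2 (volume.restrict U)

/-- Test functions: `C^∞` with compact support. -/
def IsTest {F : Type*} [NormedAddCommGroup F] [NormedSpace ℝ F] (ψ : Pt d → F) : Prop :=
  ContDiff ℝ ∞ ψ ∧ HasCompactSupport ψ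

/-- `g` is the weak derivative of `u` in the direction `e` on the open set `U`. -/
def HasWeakDeriv {F : Type*} [NormedAddCommGroup F] [NormedSpace ℝ F]
    (U : Set (Pt d)) (e : Pt d) (u g : Pt d → F) : Prop :=
  ∀ ψ : Pt d → ℝ, IsTest ψ → tsupport ψ ⊆ U →
    ∫ x in U, (fderiv ℝ ψ x e) • u x = -∫ x in U, ψ x • g x

/-- An element of `H^1(U)^N`, together with (representatives of) its weak first derivatives. -/
structure H1Field (U : Set (Pt d)) where
  val : Pt d → Pt d
  /-- the horizontal partial derivatives -/
  dT : Fin d → Pt d → Pt d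
  /-- the vertical partial derivative -/
  dz : Pt d → Pt d
  val_mem : IsL2 U val
  dT_mem : ∀ i, IsL2 U (dT i)
  dz_mem : IsL2 U dz
  dT_weak : ∀ i, HasWeakDeriv U (dirT i) val (dT i)
  dz_weak : HasWeakDeriv U dirZ val dz

/-- The horizontal divergence `∇_T · w_T`. -/
def H1Field.divT {U : Set (Pt d)} (w : H1Field U) (x : Pt d) : ℝ :=
  ∑ i : Fin d, (w.dT i x).1 i

/-- An element of `H_div(U)`, together with (a representative of) its weak divergence.
Note that `fderiv ℝ ψ x (val x) = val x · ∇ψ(x)`. -/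
structure HdivField (U : Set (Pt d)) where
  val : Pt d → Pt d
  div : Pt d → ℝ
  val_mem : IsL2 U val
  div_mem : IsL2 U div
  div_weak : ∀ ψ : Pt d → ℝ, IsTest ψ → tsupport ψ ⊆ U →
    ∫ x in U, fderiv ℝ ψ x (val x) = -∫ x in U, div x * ψ x

/-- Weak convergence in `L^2(U)`. -/
def WeakL2 (U : Set (Pt d)) (u : ℕ → Pt d → ℝ) (l : Pt d → ℝ) : Prop :=
  ∀ f : Pt d → ℝ, IsL2 U f →
    Tendsto (fun k => ∫ x in U, u k x * f x) atTop (𝓝 (∫ x in U, l x * f x))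

/-- Weak convergence in `L^2(U)^N`. -/
def WeakL2Vec (U : Set (Pt d)) (u : ℕ → Pt d → Pt d) (l : Pt d → Pt d) : Prop :=
  ∀ f : Pt d → Pt d, IsL2 U f →
    Tendsto (fun k => ∫ x in U, dot (u k x) (f x)) atTop (𝓝 (∫ x in U, dot (l x) (f x)))

/-- Weak convergence in `H_div(U)`. -/
def WeakHdiv {U : Set (Pt d)} (u : ℕ → HdivField U) (l : HdivField U) : Prop :=
  WeakL2Vec U (fun k => (u k).val) l.val ∧ WeakL2 U (fun k => (u k).div) l.div

/-- Weak convergence in `H^1(U)^N` of the scaled fields `c k • u k`. -/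
def WeakH1Scaled {U : Set (Pt d)} (c : ℕ → ℝ) (u : ℕ → H1Field U) (l : H1Field U) : Prop :=
  WeakL2Vec U (fun k x => c k • (u k).val x) l.val ∧
  (∀ i, WeakL2Vec U (fun k x => c k • (u k).dT i x) (l.dT i)) ∧
  WeakL2Vec U (fun k x => c k • (u k).dz x) l.dz

/-! ### Geometry -/

/-- The graph `{(x, ζ x) : x ∈ G}`. -/
def graphOver (G : Set (Hor d)) (ζ : Hor d → ℝ) : Set (Pt d) :=
  {x | x.1 ∈ G ∧ x.2 = ζ x.1}

/-- The cylinder `{(x, y) : x ∈ G, ζ x < y < ζ x + 1}`. -/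
def cylinderOver (G : Set (Hor d)) (ζ : Hor d → ℝ) : Set (Pt d) :=
  {x | x.1 ∈ G ∧ ζ x.1 < x.2 ∧ x.2 < ζ x.1 + 1}

/-- The geometric setting: the porous medium `Ω₁` and, above it, the reference channel `Ω₂`,
sharing the interface `Γ`, which is the graph of `ζ` over `G`. -/
structure Geometry (d : ℕ) where
  G₀ : Set (Hor d)
  G : Set (Hor d)
  ζ : Hor d → ℝ
  Ω₁ : Set (Pt d)
  G₀_open : IsOpen G₀
  G₀_conn : IsConnected G₀
  G₀_bdd : Bornology.IsBounded G₀
  G_open : IsOpen G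
  G_conn : IsConnected G
  G_sub : closure G ⊆ G₀
  ζ_C2 : ContDiffOn ℝ 2 ζ G₀
  Ω₁_open : IsOpen Ω₁
  Ω₁_conn : IsConnected Ω₁
  Ω₁_bdd : Bornology.IsBounded Ω₁
  disj : Disjoint Ω₁ (cylinderOver G ζ)
  /-- the two domains meet along (the closure of) `Γ` -/
  interface : frontier Ω₁ ∩ frontier (cylinderOver G ζ) = closure (graphOver G ζ)
  /-- `Ω = Ω₁ ∪ Γ ∪ Ω₂` is open, i.e. `Ω₁` occupies the lower side of `Γ` -/
  Ω_open : IsOpen (Ω₁ ∪ graphOver G ζ ∪ cylinderOver G ζ)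

namespace Geometry

variable (g : Geometry d)

/-- The interface. -/
def Γ : Set (Pt d) := graphOver g.G g.ζ

/-- The reference channel. -/
def Ω₂ : Set (Pt d) := cylinderOver g.G g.ζ

/-- `|(-∇_T ζ, 1)|`, the density of the surface measure `dS` of `Γ` in the chart `x ↦ (x, ζ x)`. -/
def area (x : Hor d) : ℝ := Real.sqrt (‖gradient g.ζ x‖ ^ 2 + 1)

/-- The upward unit normal to `Γ`, which is the outward normal of `Ω₁` on `Γ`. -/
def normal (x : Hor d) : Pt d := (g.area x)⁻¹ • (-(gradient g.ζ x), (1 : ℝ))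

/-- `∫_Γ F dS`, for a function `F` on `Γ` given in the chart. -/
def surfaceIntegral (F : Hor d → ℝ) : ℝ := ∫ x in g.G, F x * g.area x

/-- The tangential part `a(τ) = a - (a · n) n`. -/
def tang (x : Hor d) (a : Pt d) : Pt d := a - (dot a (g.normal x)) • g.normal x

/-- `w · n = q` on `Γ`, with `q ∈ L²(Γ)`: the normal trace of `w ∈ H_div(Ω₁)`, defined by Green's
formula, is `q` when tested with functions that vanish on the rest of `∂Ω₁`. -/
def HasNormalTrace (w : HdivField g.Ω₁) (q : Hor d → ℝ) : Prop :=
  IsL2 g.G q ∧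
  ∀ ψ : Pt d → ℝ, IsTest ψ → tsupport ψ ∩ frontier g.Ω₁ ⊆ g.Γ →
    ∫ x in g.Ω₁, (fderiv ℝ ψ x (w.val x) + w.div x * ψ x) =
      g.surfaceIntegral (fun x => q x * ψ (x, g.ζ x))

/-- `b` and `t` are the traces of `w` on `Γ` and on `Γ + 1`, both given in the chart,
through integration by parts in the vertical direction. -/
def HasTraces (w : H1Field g.Ω₂) (b t : Hor d → Pt d) : Prop :=
  IsL2 g.G b ∧ IsL2 g.G t ∧
  ∀ ψ : Pt d → ℝ, IsTest ψ →
    ∫ x in g.Ω₂, ((fderiv ℝ ψ x dirZ) • w.val x + ψ x • w.dz x) =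
      ∫ x in g.G, (ψ (x, g.ζ x + 1) • t x - ψ (x, g.ζ x) • b x)

/-- `w = 0` on the lateral wall of `Ω₂`: `w` is the `H^1(Ω₂)`-limit of smooth fields whose support
lies over a compact subset of `G`. -/
def VanishesLaterally (w : H1Field g.Ω₂) : Prop :=
  ∀ δ : ENNReal, 0 < δ → ∃ Φ : Pt d → Pt d, IsTest Φ ∧ tsupport Φ ⊆ g.G ×ˢ Set.univ ∧
    eLpNorm (fun x => w.val x - Φ x) 2 (volume.restrict g.Ω₂) < δ ∧
    (∀ i, eLpNorm (fun x => w.dT i x - fderiv ℝ Φ x (dirT i)) 2 (volume.restrict g.Ω₂) < δ) ∧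
    eLpNorm (fun x => w.dz x - fderiv ℝ Φ x dirZ) 2 (volume.restrict g.Ω₂) < δ

/-- The velocity space `X₂`: fields in `H^1(Ω₂)^N` vanishing on the lateral wall and with zero
normal component on `Γ + 1`. -/
structure X₂ extends H1Field g.Ω₂ where
  /-- trace on `Γ` -/
  bot : Hor d → Pt d
  /-- trace on `Γ + 1` -/
  top : Hor d → Pt d
  traces : g.HasTraces toH1Field bot top
  lateral : g.VanishesLaterally toH1Field
  top_normal : ∀ᵐ x ∂(volume.restrict g.G), dot (top x) (g.normal x) = 0

/-- The velocity space `X`: pairs in `H_div(Ω₁) × X₂` with `w¹ · n = w² · n` on `Γ`. -/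
structure X where
  one : HdivField g.Ω₁
  two : g.X₂
  matching : g.HasNormalTrace one (fun x => dot (two.bot x) (g.normal x))

/-- `w · n` on `Γ`, for `w ∈ X`. -/
def X.normalTrace {g : Geometry d} (w : g.X) (x : Hor d) : ℝ :=
  dot (w.two.bot x) (g.normal x)

/-- The pressure space `Y = L²(Ω) = L²(Ω₁) × L²(Ω₂)`. -/
structure Y where
  one : Pt d → ℝ
  two : Pt d → ℝ
  one_mem : IsL2 g.Ω₁ one
  two_mem : IsL2 g.Ω₂ two

end Geometry

/-! ### Coefficients and the scaled Darcy-Stokes problem -/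

/-- The square root with nonnegative quadratic form (for a symmetric positive definite tensor this
is the usual positive square root; an elliptic tensor has exactly one). -/
def tensorSqrt (A : Pt d →ₗ[ℝ] Pt d) : Pt d →ₗ[ℝ] Pt d :=
  Classical.epsilon (fun S : Pt d →ₗ[ℝ] Pt d => S ∘ₗ S = A ∧ ∀ a, 0 ≤ dot (S a) a)

/-- The coefficients of the problem. -/
structure Coefficients (g : Geometry d) where
  /-- viscosity -/
  μ : Pt d → ℝ
  /-- fluid entry resistance, in the chart of `Γ` -/
  α : Hor d → ℝ
  /-- slip coefficient, in the chart of `Γ` -/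
  β : Hor d → ℝ
  /-- flow resistance tensor -/
  Q : Pt d → (Pt d →ₗ[ℝ] Pt d)
  μ_meas : Measurable μ
  μ_pos : ∀ x ∈ g.Ω₂, 0 < μ x
  μ_bdd : ∃ C : ℝ, ∀ x ∈ g.Ω₂, μ x ≤ C
  α_meas : Measurable α
  α_nonneg : ∀ᵐ x ∂(volume.restrict g.G), 0 ≤ α x
  α_bdd : ∃ C : ℝ, ∀ᵐ x ∂(volume.restrict g.G), α x ≤ C
  β_meas : Measurable β
  β_nonneg : ∀ᵐ x ∂(volume.restrict g.G), 0 ≤ β x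
  β_bdd : ∃ C : ℝ, ∀ᵐ x ∂(volume.restrict g.G), β x ≤ C
  Q_meas : ∀ a, Measurable (fun x => Q x a)
  Q_bdd : ∃ C : ℝ, ∀ x ∈ g.Ω₁ ∪ g.Γ, ∀ a, ‖Q x a‖ ≤ C * ‖a‖
  Q_elliptic : ∃ C : ℝ, 0 < C ∧ ∀ x ∈ g.Ω₁ ∪ g.Γ, ∀ a, C * dot a a ≤ dot (Q x a) a

namespace Geometry

variable (g : Geometry d)

/-- The `i`-th column of `D^ε w = ∇_T w + (1 - 1/ε) ∂_z w ∇_T ζ`. -/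
def Deps (ε : ℝ) (w : H1Field g.Ω₂) (i : Fin d) (x : Pt d) : Pt d :=
  w.dT i x + ((1 - 1 / ε) * (gradient g.ζ x.1) i) • w.dz x

/-- The momentum equation of the problem on the reference domain, tested with `w ∈ X`. -/
def Momentum (c : Coefficients g) (ε : ℝ) (f : Pt d → Pt d) (v : g.X) (p : g.Y) (w : g.X) : Prop :=
  (∫ x in g.Ω₁, dot (c.Q x (v.one.val x)) (w.one.val x))
  - (∫ x in g.Ω₁, p.one x * w.one.div x)
  - ε * (∫ x in g.Ω₂, p.two x * w.two.divT x)
  - ε * (1 - 1 / ε) * (∫ x in g.Ω₂, p.two x * inner ℝ (w.two.dz x).1 (gradient g.ζ x.1))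
  - (∫ x in g.Ω₂, p.two x * (w.two.dz x).2)
  + ε ^ 2 * (∫ x in g.Ω₂, c.μ x *
      ∑ i : Fin d, dot (g.Deps ε v.two.toH1Field i x) (g.Deps ε w.two.toH1Field i x))
  + (∫ x in g.Ω₂, c.μ x * inner ℝ (v.two.dz x).1 (w.two.dz x).1)
  + (∫ x in g.Ω₂, c.μ x * ((v.two.dz x).2 * (w.two.dz x).2))
  + g.surfaceIntegral (fun x => c.α x * (v.normalTrace x * w.normalTrace x))
  + ε ^ 2 * g.surfaceIntegral (fun x => c.β x *
      dot (tensorSqrt (c.Q (x, g.ζ x)) (g.tang x (v.two.bot x))) (g.tang x (w.two.bot x)))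
  = ε * ∫ x in g.Ω₂, dot (f x) (w.two.val x)

/-- The mass conservation equation of the problem on the reference domain, tested with `φ ∈ Y`. -/
def MassBalance (ε : ℝ) (h : Pt d → ℝ) (v : g.X) (φ : g.Y) : Prop :=
  (∫ x in g.Ω₁, v.one.div x * φ.one x)
  + ε * (∫ x in g.Ω₂, v.two.divT x * φ.two x)
  + ε * (1 - 1 / ε) * (∫ x in g.Ω₂, inner ℝ (v.two.dz x).1 (gradient g.ζ x.1) * φ.two x)
  + (∫ x in g.Ω₂, (v.two.dz x).2 * φ.two x)
  = ∫ x in g.Ω₁, h x * φ.one x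

/-- `[v, p] ∈ X × Y` solves the `ε`-problem on the reference domain with forcing terms `f`, `h`. -/
def IsSolution (c : Coefficients g) (ε : ℝ) (f : Pt d → Pt d) (h : Pt d → ℝ)
    (v : g.X) (p : g.Y) : Prop :=
  (∀ w : g.X, g.Momentum c ε f v p w) ∧ ∀ φ : g.Y, g.MassBalance ε h v φ

end Geometry

end DarcyStokes

end

/-!
Only the mass balance of the `ε`-problem is needed. Tested in `Ω₁` it reads `∇ · v^{1,ε} = h^{1,ε}`,
which passes to the weak limit (`ae_div_eq_of_weak_limit`).

Tested with a function `φ` of `Ω₂` independent of `z`, its only terms without a factor `ε` add up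
to the integral of `φ (-∇_T ζ, 1) · ∂_z v^{2,ε}`. Integrating along the columns
`{x} × (ζ x, ζ x + 1)` turns this into a difference of traces on `Γ + 1` and `Γ`
(`HasTraces.columnMean_dz`); the one on `Γ + 1` vanishes since `v^{2,ε} · n = 0` there, and the one
on `Γ` is the flux of `v^{1,ε}` (`surfaceIntegral_bot`). Hence
`∫_Γ (v^{1,ε} · n) φ dS = ε ∫ ∇_T · v^{2,ε}_T φ + ε ∫ ∂_z v^{2,ε}_T · ∇_T ζ φ`, whose right-hand side
tends to `∫ ∇_T · v²_T φ` because `∂_z v^{2,ε}` converges weakly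
(`tendsto_surfaceIntegral_normalTrace`).

The limit functional of `φ` is represented explicitly by the function `q ∈ L²(Γ)` for which
`|(-∇_T ζ, 1)| q` is the column integral of `∇_T · v²_T`, so no duality argument is needed. Since
Green's formula in `Ω₁` passes to the limit for each test function (`tendsto_green`), `q` is the
normal trace of `v¹` (`exists_hasNormalTrace_of_weak_limit`).
-/

namespace DarcyStokes

/-! ### Columns of a cylinder over a graph -/

section Columns

variable {d : ℕ} {E : Type*} [NormedAddCommGroup E]

/-- The chart `(x, s) ↦ (x, ζ x + s)`, which maps `G × (0, 1)` onto the cylinder over `G`. Outside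
`G` the function `ζ` is replaced by `0`, so that the map is globally measurable. -/
noncomputable def shear (G : Set (Hor d)) (ζ : Hor d → ℝ) (y : Pt d) : Pt d :=
  (y.1, G.indicator ζ y.1 + y.2)

/-- The integral of `F` over the vertical segment of unit length above `(x, ζ x)`. -/
noncomputable def columnMean [NormedSpace ℝ E] (G : Set (Hor d)) (ζ : Hor d → ℝ) (F : Pt d → E)
    (x : Hor d) : E :=
  ∫ s in Set.Ioo (0 : ℝ) 1, F (shear G ζ (x, s))

instance isProbabilityMeasure_restrict_Ioo :
    IsProbabilityMeasure ((volume : Measure ℝ).restrict (Set.Ioo 0 1)) :=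
  ⟨by simp⟩

variable {G : Set (Hor d)} {ζ : Hor d → ℝ}

theorem measurable_indicator_of_continuousOn (hG : MeasurableSet G) (hζ : ContinuousOn ζ G) :
    Measurable (G.indicator ζ) := by
  classical
  rw [← Set.piecewise_eq_indicator]
  exact hζ.measurable_piecewise continuousOn_const hG

theorem measurableSet_cylinderOver (hG : MeasurableSet G) (hζ : ContinuousOn ζ G) :
    MeasurableSet (cylinderOver G ζ) := by
  have hm : Measurable fun x : Pt d => G.indicator ζ x.1 :=
    (measurable_indicator_of_continuousOn hG hζ).comp measurable_fst
  have : cylinderOver G ζ = {x : Pt d | x.1 ∈ G} ∩ {x | G.indicator ζ x.1 < x.2} ∩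
      {x | x.2 < G.indicator ζ x.1 + 1} := by
    ext x
    by_cases hx : x.1 ∈ G <;> simp [cylinderOver, hx]
  rw [this]
  exact ((measurable_fst hG).inter (measurableSet_lt hm measurable_snd)).inter
    (measurableSet_lt measurable_snd (hm.add_const 1))

theorem measurePreserving_shear (hG : MeasurableSet G) (hζ : ContinuousOn ζ G) :
    MeasurePreserving (shear G ζ) ((volume.restrict G).prod (volume.restrict (Set.Ioo 0 1)))
      (volume.restrict (cylinderOver G ζ)) := by
  have h0 : MeasurePreserving (shear G ζ) ((volume : Measure (Hor d)).prod (volume : Measure ℝ))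
      ((volume : Measure (Hor d)).prod (volume : Measure ℝ)) :=
    (MeasurePreserving.id (volume : Measure (Hor d))).skew_product
      (g := fun x s => G.indicator ζ x + s)
      (((measurable_indicator_of_continuousOn hG hζ).comp measurable_fst).add measurable_snd)
      (ae_of_all _ fun x => map_add_left_eq_self volume _)
  have hpre : shear G ζ ⁻¹' cylinderOver G ζ = G ×ˢ Set.Ioo (0 : ℝ) 1 := by
    ext x
    by_cases hx : x.1 ∈ G <;> simp [cylinderOver, shear, hx]
  rw [Measure.prod_restrict, ← hpre]
  exact h0.restrict_preimage (measurableSet_cylinderOver hG hζ)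

theorem measurePreserving_fst_cylinderOver (hG : MeasurableSet G) (hζ : ContinuousOn ζ G) :
    MeasurePreserving Prod.fst (volume.restrict (cylinderOver G ζ)) (volume.restrict G) := by
  refine ⟨measurable_fst, ?_⟩
  rw [← (measurePreserving_shear hG hζ).map_eq, Measure.map_map measurable_fst
    (measurePreserving_shear hG hζ).measurable]
  exact (measurePreserving_fst (μ := volume.restrict G)
    (ν := (volume : Measure ℝ).restrict (Set.Ioo 0 1))).map_eq

theorem ae_integrable_column (hG : MeasurableSet G) (hζ : ContinuousOn ζ G) {F : Pt d → E}
    (hF : Integrable F (volume.restrict (cylinderOver G ζ))) :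
    ∀ᵐ x ∂volume.restrict G,
      Integrable (fun s => F (shear G ζ (x, s))) (volume.restrict (Set.Ioo 0 1)) :=
  ((measurePreserving_shear hG hζ).integrable_comp_of_integrable hF).prod_right_ae

variable [NormedSpace ℝ E]

theorem integral_cylinderOver (hG : MeasurableSet G) (hζ : ContinuousOn ζ G) {F : Pt d → E}
    (hF : Integrable F (volume.restrict (cylinderOver G ζ))) :
    ∫ x in cylinderOver G ζ, F x = ∫ x in G, columnMean G ζ F x := by
  have hS := measurePreserving_shear hG hζ
  have hF' := hS.integrable_comp_of_integrable hF
  rw [← hS.map_eq] at hF ⊢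
  rw [integral_map hS.measurable.aemeasurable hF.aestronglyMeasurable]
  exact integral_prod _ hF'

theorem integrable_columnMean (hG : MeasurableSet G) (hζ : ContinuousOn ζ G) {F : Pt d → E}
    (hF : Integrable F (volume.restrict (cylinderOver G ζ))) :
    Integrable (columnMean G ζ F) (volume.restrict G) :=
  ((measurePreserving_shear hG hζ).integrable_comp_of_integrable hF).integral_prod_left

/-- By Jensen's inequality in each column, averaging over columns maps `L²` to `L²`. -/
theorem memLp_two_columnMean (hG : MeasurableSet G) (hζ : ContinuousOn ζ G) {F : Pt d → E}
    (hF : MemLp F 2 (volume.restrict (cylinderOver G ζ))) :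
    MemLp (columnMean G ζ F) 2 (volume.restrict G) := by
  have hF' := hF.comp_measurePreserving (measurePreserving_shear hG hζ)
  have hsq := (memLp_two_iff_integrable_sq_norm hF'.1).1 hF'
  have hmeas : AEStronglyMeasurable (columnMean G ζ F) (volume.restrict G) :=
    hF'.1.integral_prod_right'
  refine (memLp_two_iff_integrable_sq_norm hmeas).2
    (hsq.integral_prod_left.mono' (hmeas.norm.pow 2) ?_)
  filter_upwards [hsq.prod_right_ae, hF'.1.prodMk_left] with x hx hxm
  have hL2 : MemLp (fun s => ‖(F ∘ shear G ζ) (x, s)‖) 2 (volume.restrict (Set.Ioo (0 : ℝ) 1)) :=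
    ((memLp_two_iff_integrable_sq_norm hxm).2 hx).norm
  have hvar := ProbabilityTheory.variance_nonneg (fun s => ‖(F ∘ shear G ζ) (x, s)‖)
    (volume.restrict (Set.Ioo (0 : ℝ) 1))
  rw [ProbabilityTheory.variance_eq_sub hL2] at hvar
  rw [norm_pow, norm_norm]
  refine (pow_le_pow_left₀ (norm_nonneg _) (norm_integral_le_integral_norm _) 2).trans ?_
  exact sub_nonneg.1 hvar

theorem columnMean_smul (φ : Hor d → ℝ) (F : Pt d → E) (x : Hor d) :
    columnMean G ζ (fun y => φ y.1 • F y) x = φ x • columnMean G ζ F x :=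
  integral_smul (φ x) _

end Columns

/-! ### The geometry of the channel -/

namespace Geometry

variable {d : ℕ} (g : Geometry d)

theorem continuousOn_ζ : ContinuousOn g.ζ g.G :=
  g.ζ_C2.continuousOn.mono (subset_closure.trans g.G_sub)

theorem measurableSet_G : MeasurableSet g.G := g.G_open.measurableSet

theorem measurableSet_Ω₂ : MeasurableSet g.Ω₂ :=
  measurableSet_cylinderOver g.measurableSet_G g.continuousOn_ζ

theorem isCompact_closure_G : IsCompact (closure g.G) :=
  (g.G₀_bdd.subset (subset_closure.trans g.G_sub)).isCompact_closure

instance isFiniteMeasure_G : IsFiniteMeasure (volume.restrict g.G) :=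
  isFiniteMeasure_restrict.2
    ((measure_mono subset_closure).trans_lt g.isCompact_closure_G.measure_lt_top).ne

theorem measurePreserving_fst_Ω₂ :
    MeasurePreserving Prod.fst (volume.restrict g.Ω₂) (volume.restrict g.G) :=
  measurePreserving_fst_cylinderOver g.measurableSet_G g.continuousOn_ζ

instance isFiniteMeasure_Ω₂ : IsFiniteMeasure (volume.restrict g.Ω₂) := by
  constructor
  rw [← Set.preimage_univ (f := Prod.fst),
    g.measurePreserving_fst_Ω₂.measure_preimage MeasurableSet.univ.nullMeasurableSet]
  exact measure_lt_top _ _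

theorem exists_abs_ζ_le : ∃ R, 0 < R ∧ ∀ x ∈ g.G, |g.ζ x| ≤ R := by
  obtain ⟨R, hR⟩ := g.isCompact_closure_G.exists_bound_of_continuousOn
    (g.ζ_C2.continuousOn.mono g.G_sub)
  exact ⟨max R 1, by positivity, fun x hx => (hR x (subset_closure hx)).trans (le_max_left _ _)⟩

theorem measurable_gradient_ζ : Measurable (gradient g.ζ) :=
  (InnerProductSpace.toDual ℝ (Hor d)).symm.continuous.measurable.comp (measurable_fderiv ℝ g.ζ)

theorem exists_norm_gradient_ζ_le : ∃ C, ∀ x ∈ g.G, ‖gradient g.ζ x‖ ≤ C := by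
  obtain ⟨C, hC⟩ := g.isCompact_closure_G.exists_bound_of_continuousOn
    ((g.ζ_C2.continuousOn_fderiv_of_isOpen g.G₀_open (by norm_num)).mono g.G_sub)
  refine ⟨C, fun x hx => ?_⟩
  rw [gradient, LinearIsometryEquiv.norm_map]
  exact hC x (subset_closure hx)

theorem memLp_top_gradient_ζ : MemLp (gradient g.ζ) ⊤ (volume.restrict g.G) := by
  obtain ⟨C, hC⟩ := g.exists_norm_gradient_ζ_le
  exact memLp_top_of_bound g.measurable_gradient_ζ.aestronglyMeasurable C
    (ae_restrict_of_forall_mem g.measurableSet_G hC)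

theorem one_le_area (x : Hor d) : 1 ≤ g.area x :=
  Real.one_le_sqrt.2 (by nlinarith [sq_nonneg ‖gradient g.ζ x‖])

theorem measurable_area : Measurable g.area :=
  ((g.measurable_gradient_ζ.norm.pow_const 2).add_const 1).sqrt

theorem area_mul_dot_normal (x : Hor d) (a : Pt d) :
    g.area x * dot a (g.normal x) = a.2 - inner ℝ a.1 (gradient g.ζ x) := by
  have h : g.area x ≠ 0 := (zero_lt_one.trans_le (g.one_le_area x)).ne'
  simp only [dot, normal, Prod.smul_fst, Prod.smul_snd, inner_smul_right, inner_neg_right,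
    smul_eq_mul]
  field_simp
  ring

/-! ### Vertical integration of the normal derivative -/

/-- The fundamental theorem of calculus in almost every column, in terms of the traces. -/
theorem HasTraces.columnMean_dz {g : Geometry d} {w : H1Field g.Ω₂} {b t : Hor d → Pt d}
    (h : g.HasTraces w b t) :
    ∀ᵐ x ∂volume.restrict g.G, columnMean g.G g.ζ w.dz x = t x - b x := by
  obtain ⟨hb, ht, hw⟩ := h
  have hdz : Integrable w.dz (volume.restrict g.Ω₂) := w.dz_mem.integrable one_le_two
  have hA := integrable_columnMean g.measurableSet_G g.continuousOn_ζ hdz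
  have htb : Integrable (fun x => t x - b x) (volume.restrict g.G) :=
    (ht.integrable one_le_two).sub (hb.integrable one_le_two)
  have key := ae_eq_zero_of_integral_contDiff_smul_eq_zero (μ := volume.restrict g.G)
    (hA.sub htb).locallyIntegrable ?_
  · filter_upwards [key] with x hx using sub_eq_zero.1 hx
  intro η hη hηc
  obtain ⟨C, hC⟩ := hηc.exists_bound_of_continuous hη.continuous
  obtain ⟨R, hR, hζR⟩ := g.exists_abs_ζ_le
  -- `η` is extended to a test function by a vertical cutoff equal to `1` on the range of heights
  -- of `Ω₂`, so that its vertical derivative vanishes there.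
  let θ : ContDiffBump (0 : ℝ) := ⟨R + 2, R + 3, by positivity, by linarith⟩
  let ψ : Pt d → ℝ := fun y => η y.1 * θ y.2
  have hψ : IsTest ψ := by
    refine ⟨(hη.comp contDiff_fst).mul (θ.contDiff.comp contDiff_snd), ?_⟩
    refine HasCompactSupport.intro (hηc.isCompact.prod θ.hasCompactSupport.isCompact) fun y hy => ?_
    by_contra hne
    exact hy ⟨subset_tsupport _ (left_ne_zero_of_mul hne),
      subset_tsupport _ (right_ne_zero_of_mul hne)⟩
  have hθ1 : ∀ z : ℝ, |z| < R + 2 → θ z = 1 := fun z hz =>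
    θ.one_of_mem_closedBall (by simpa [θ] using hz.le)
  have hψ' : ∀ y : Pt d, |y.2| < R + 2 → fderiv ℝ ψ y dirZ = 0 := by
    intro y hy
    have hev : ψ =ᶠ[𝓝 y] fun z : Pt d => η z.1 := by
      filter_upwards [(isOpen_lt (continuous_abs.comp continuous_snd) continuous_const).mem_nhds hy]
        with z hz
      simp only [ψ, hθ1 z.2 hz, mul_one]
    have hη1 : DifferentiableAt ℝ η y.1 := hη.differentiable (by simp) _
    have hcomp := hη1.hasFDerivAt.comp y (hasFDerivAt_fst (𝕜 := ℝ) (p := y))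
    rw [hev.fderiv_eq, show (fun z : Pt d => η z.1) = η ∘ Prod.fst from rfl, hcomp.fderiv]
    simp [dirZ]
  have hheight : ∀ y ∈ g.Ω₂, |y.2| < R + 2 := by
    rintro y ⟨hy, h1, h2⟩
    have := abs_le.1 (hζR _ hy)
    exact abs_lt.2 ⟨by linarith, by linarith⟩
  have e1 : ∫ x in g.Ω₂, ((fderiv ℝ ψ x dirZ) • w.val x + ψ x • w.dz x) =
      ∫ x in g.Ω₂, η x.1 • w.dz x := by
    refine setIntegral_congr_fun g.measurableSet_Ω₂ fun y hy => ?_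
    simp only [hψ' y (hheight y hy), zero_smul, zero_add, ψ, hθ1 _ (hheight y hy), mul_one]
  have e2 : ∫ x in g.G, (ψ (x, g.ζ x + 1) • t x - ψ (x, g.ζ x) • b x) =
      ∫ x in g.G, η x • (t x - b x) := by
    refine setIntegral_congr_fun g.measurableSet_G fun x hx => ?_
    have hx' := abs_le.1 (hζR x hx)
    have h1 := hθ1 (g.ζ x) (abs_lt.2 ⟨by linarith, by linarith⟩)
    have h2 := hθ1 (g.ζ x + 1) (abs_lt.2 ⟨by linarith, by linarith⟩)
    simp only [ψ, h1, h2, mul_one, smul_sub]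
  have hbd : ∀ {F : Hor d → Pt d}, Integrable F (volume.restrict g.G) →
      Integrable (fun x => η x • F x) (volume.restrict g.G) := fun hF =>
    hF.bdd_smul C hη.continuous.aestronglyMeasurable (ae_of_all _ hC)
  have hint : Integrable (fun y : Pt d => η y.1 • w.dz y) (volume.restrict g.Ω₂) :=
    hdz.bdd_smul C (hη.continuous.comp continuous_fst).aestronglyMeasurable
      (ae_of_all _ fun y => hC y.1)
  have e3 := integral_cylinderOver g.measurableSet_G g.continuousOn_ζ hint
  simp only [columnMean_smul] at e3
  simp only [Pi.sub_apply, smul_sub]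
  have := hw ψ hψ
  rw [e1, e2] at this
  rw [show (∫ x in g.G, η x • columnMean g.G g.ζ w.dz x - (η x • t x - η x • b x)) =
    ∫ x in g.G, (η x • columnMean g.G g.ζ w.dz x - η x • (t x - b x)) by simp only [smul_sub],
    integral_sub (hbd hA) (hbd htb), ← e3, ← this]
  exact sub_self _

/-- The linear form `a ↦ a_T · ∇ζ - a_N`, which is `-|(-∇ζ, 1)|` times the normal component. -/
noncomputable def conormal (x : Hor d) : Pt d →L[ℝ] ℝ :=
  (innerSL ℝ (gradient g.ζ x)).comp (ContinuousLinearMap.fst ℝ (Hor d) ℝ) -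
    ContinuousLinearMap.snd ℝ (Hor d) ℝ

theorem conormal_apply (x : Hor d) (a : Pt d) :
    g.conormal x a = inner ℝ a.1 (gradient g.ζ x) - a.2 := by
  simp [conormal]

theorem memLp_comp_fst {E : Type*} [NormedAddCommGroup E] {p : ENNReal} {φ : Hor d → E}
    (hφ : MemLp φ p (volume.restrict g.G)) :
    MemLp (fun y : Pt d => φ y.1) p (volume.restrict g.Ω₂) :=
  hφ.comp_measurePreserving g.measurePreserving_fst_Ω₂

theorem memLp_smul_gradient {φ : Hor d → ℝ} (hφ : IsL2 g.G φ) :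
    IsL2 g.G (fun x => φ x • gradient g.ζ x) :=
  g.memLp_top_gradient_ζ.smul hφ

theorem _root_.DarcyStokes.IsL2.integrable_inner {F : Type*} [NormedAddCommGroup F]
    [InnerProductSpace ℝ F] {U : Set (Pt d)} {u v : Pt d → F} (hu : IsL2 U u) (hv : IsL2 U v) :
    Integrable (fun x => inner ℝ (u x) (v x)) (volume.restrict U) :=
  memLp_one_iff_integrable.1 <| hu.of_bilin (fun a b => inner ℝ a b) 1 hv (hu.1.inner hv.1)
    (ae_of_all _ fun x => by
      rw [one_mul]
      exact nnnorm_inner_le_nnnorm (u x) (v x))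

theorem integrable_inner_gradient_mul {u : Pt d → Pt d} (hu : IsL2 g.Ω₂ u) {φ : Hor d → ℝ}
    (hφ : IsL2 g.G φ) :
    Integrable (fun y => inner ℝ (u y).1 (gradient g.ζ y.1) * φ y.1) (volume.restrict g.Ω₂) := by
  have h := IsL2.integrable_inner hu.fst (g.memLp_comp_fst (g.memLp_smul_gradient hφ))
  refine h.congr (ae_of_all _ fun y => ?_)
  simp only [inner_smul_right]
  exact mul_comm _ _

/-- The flux of `w ∈ X₂` through `Γ`, weighted by a function independent of `z`, equals the column
integrals of `-|(-∇ζ, 1)| ∂_z w · n`, because `w · n = 0` on `Γ + 1`. -/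
theorem surfaceIntegral_bot (w : g.X₂) {φ : Hor d → ℝ} (hφ : IsL2 g.G φ) :
    g.surfaceIntegral (fun x => dot (w.bot x) (g.normal x) * φ x) =
      (∫ y in g.Ω₂, inner ℝ (w.dz y).1 (gradient g.ζ y.1) * φ y.1) -
        ∫ y in g.Ω₂, (w.dz y).2 * φ y.1 := by
  have hφ' := g.memLp_comp_fst hφ
  have i1 := g.integrable_inner_gradient_mul w.dz_mem hφ
  have i2 : Integrable (fun y => (w.dz y).2 * φ y.1) (volume.restrict g.Ω₂) :=
    w.dz_mem.snd.integrable_mul hφ'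
  have hdz : Integrable w.dz (volume.restrict g.Ω₂) := w.dz_mem.integrable one_le_two
  have i3 : Integrable (fun y => φ y.1 • g.conormal y.1 (w.dz y)) (volume.restrict g.Ω₂) := by
    refine (i1.sub i2).congr (ae_of_all _ fun y => ?_)
    simp only [Pi.sub_apply, conormal_apply, smul_eq_mul]
    ring
  have e := integral_cylinderOver g.measurableSet_G g.continuousOn_ζ i3
  simp only [columnMean_smul] at e
  rw [← integral_sub i1 i2]
  calc g.surfaceIntegral (fun x => dot (w.bot x) (g.normal x) * φ x)
      = ∫ x in g.G, φ x • columnMean g.G g.ζ (fun y => g.conormal y.1 (w.dz y)) x := by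
        refine integral_congr_ae ?_
        filter_upwards [w.traces.columnMean_dz, w.top_normal,
          ae_integrable_column g.measurableSet_G g.continuousOn_ζ hdz] with x hx htop hint
        have h1 : columnMean g.G g.ζ (fun y => g.conormal y.1 (w.dz y)) x =
            g.conormal x (columnMean g.G g.ζ w.dz x) :=
          (g.conormal x).integral_comp_comm hint
        have h2 := g.area_mul_dot_normal x (w.bot x)
        have h3 := g.area_mul_dot_normal x (w.top x)
        rw [htop, mul_zero] at h3
        rw [h1, hx, map_sub, conormal_apply, conormal_apply, smul_eq_mul]
        linear_combination φ x * h2 - φ x * h3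
    _ = ∫ y in g.Ω₂, φ y.1 • g.conormal y.1 (w.dz y) := e.symm
    _ = _ := by
        refine integral_congr_ae (ae_of_all _ fun y => ?_)
        simp only [conormal_apply, smul_eq_mul]
        ring

/-! ### The limit of the mass balance -/

theorem memLp_divT (w : H1Field g.Ω₂) : IsL2 g.Ω₂ w.divT := by
  refine memLp_finsetSum _ fun i _ => ?_
  exact (EuclideanSpace.proj i : Hor d →L[ℝ] ℝ).comp_memLp' (w.dT_mem i).fst

/-- Testing the mass balance with a function of the channel that is independent of `z`. -/
theorem MassBalance.surfaceIntegral_normalTrace {g : Geometry d} {ε : ℝ} (hε : ε ≠ 0)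
    {h : Pt d → ℝ} {v : g.X} (hv : ∀ φ : g.Y, g.MassBalance ε h v φ) {φ : Hor d → ℝ}
    (hφ : IsL2 g.G φ) :
    g.surfaceIntegral (fun x => v.normalTrace x * φ x) =
      ε * (∫ y in g.Ω₂, v.two.divT y * φ y.1) +
        ε * ∫ y in g.Ω₂, inner ℝ (v.two.dz y).1 (gradient g.ζ y.1) * φ y.1 := by
  have hb := hv ⟨0, fun y => φ y.1, MemLp.zero', g.memLp_comp_fst hφ⟩
  simp only [MassBalance, Pi.zero_apply, mul_zero, integral_zero, zero_add] at hb
  have hs := g.surfaceIntegral_bot v.two hφ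
  have h1 : ε * (1 - 1 / ε) = ε - 1 := by field_simp
  rw [h1] at hb
  simp only [X.normalTrace]
  linarith

/-- The normal fluxes through `Γ` converge weakly: in the identity above the term with `∂_z v²`
is `ε` times a convergent sequence, and only the horizontal divergence of `ε v²` survives. -/
theorem tendsto_surfaceIntegral_normalTrace {g : Geometry d} {ε : ℕ → ℝ} (hε_pos : ∀ k, 0 < ε k)
    (hε : Tendsto ε atTop (𝓝 0)) {h : ℕ → Pt d → ℝ} {v : ℕ → g.X}
    (hv : ∀ k, ∀ φ : g.Y, g.MassBalance (ε k) (h k) (v k) φ)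
    {χ : Pt d → Pt d} (hχ : WeakL2Vec g.Ω₂ (fun k => (v k).two.dz) χ)
    {v₂ : H1Field g.Ω₂} (hv₂ : WeakH1Scaled ε (fun k => (v k).two.toH1Field) v₂)
    {φ : Hor d → ℝ} (hφ : IsL2 g.G φ) :
    Tendsto (fun k => g.surfaceIntegral (fun x => (v k).normalTrace x * φ x)) atTop
      (𝓝 (∫ y in g.Ω₂, v₂.divT y * φ y.1)) := by
  have hφ' := g.memLp_comp_fst hφ
  have hsum : ∀ w : H1Field g.Ω₂, ∫ y in g.Ω₂, w.divT y * φ y.1 =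
      ∑ i : Fin d, ∫ y in g.Ω₂, (w.dT i y).1 i * φ y.1 := by
    intro w
    simp only [H1Field.divT, Finset.sum_mul]
    refine integral_finsetSum _ fun i _ => ?_
    exact ((EuclideanSpace.proj i : Hor d →L[ℝ] ℝ).comp_memLp'
      (w.dT_mem i).fst).integrable_mul hφ'
  have t1 : Tendsto (fun k => ε k * ∫ y in g.Ω₂, (v k).two.divT y * φ y.1) atTop
      (𝓝 (∫ y in g.Ω₂, v₂.divT y * φ y.1)) := by
    simp only [hsum, Finset.mul_sum]
    refine tendsto_finsetSum _ fun i _ => ?_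
    have hL : IsL2 g.Ω₂ (fun y : Pt d => φ y.1 • (dirT i : Pt d)) :=
      (ContinuousLinearMap.toSpanSingleton ℝ (dirT i : Pt d)).comp_memLp' hφ'
    convert hv₂.2.1 i _ hL using 1
    · funext k
      rw [← integral_const_mul]
      refine integral_congr_ae (ae_of_all _ fun y => ?_)
      simp [dot, dirT, inner_smul_right, EuclideanSpace.inner_single_right]
      ring
    · congr 1
      refine integral_congr_ae (ae_of_all _ fun y => ?_)
      simp [dot, dirT, inner_smul_right, EuclideanSpace.inner_single_right]
      ring
  have t2 : Tendsto (fun k => ∫ y in g.Ω₂,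
      inner ℝ ((v k).two.dz y).1 (gradient g.ζ y.1) * φ y.1) atTop
      (𝓝 (∫ y in g.Ω₂, inner ℝ (χ y).1 (gradient g.ζ y.1) * φ y.1)) := by
    have hL : IsL2 g.Ω₂ (fun y : Pt d => ((φ y.1 • gradient g.ζ y.1, 0) : Pt d)) :=
      (ContinuousLinearMap.inl ℝ (Hor d) ℝ).comp_memLp'
        (g.memLp_comp_fst (g.memLp_smul_gradient hφ))
    have := hχ _ hL
    simpa only [dot, inner_smul_right, mul_zero, add_zero, mul_comm (φ _)] using this
  have t3 := t1.add (hε.mul t2)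
  rw [zero_mul, add_zero] at t3
  refine t3.congr fun k => ?_
  exact (MassBalance.surfaceIntegral_normalTrace (hε_pos k).ne' (hv k) hφ).symm

theorem _root_.DarcyStokes.IsL2.integrable_dot {U : Set (Pt d)} {u v : Pt d → Pt d}
    (hu : IsL2 U u) (hv : IsL2 U v) :
    Integrable (fun x => dot (u x) (v x)) (volume.restrict U) :=
  (IsL2.integrable_inner hu.fst hv.fst).add (hu.snd.integrable_mul hv.snd)

theorem isL2_Ω₁_of_continuous {F : Type*} [NormedAddCommGroup F]
    [SecondCountableTopologyEither (Pt d) F] {u : Pt d → F} (hu : Continuous u) :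
    IsL2 g.Ω₁ u := by
  have hK : IsCompact (closure g.Ω₁) := g.Ω₁_bdd.isCompact_closure
  have : IsFiniteMeasure (volume.restrict g.Ω₁) :=
    isFiniteMeasure_restrict.2 ((measure_mono subset_closure).trans_lt hK.measure_lt_top).ne
  obtain ⟨C, hC⟩ := hK.exists_bound_of_continuousOn hu.continuousOn
  exact MemLp.of_bound hu.aestronglyMeasurable C
    (ae_restrict_of_forall_mem g.Ω₁_open.measurableSet fun x hx => hC x (subset_closure hx))

/-- The gradient of a scalar function with respect to `dot`. The product norm of `Pt d` is not the
Euclidean one, so `gradient` does not apply to functions on `Pt d`. -/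
noncomputable def dotGradient (ψ : Pt d → ℝ) (x : Pt d) : Pt d :=
  ∑ i : Fin d, fderiv ℝ ψ x (dirT i) • dirT i + fderiv ℝ ψ x dirZ • dirZ

theorem fderiv_eq_dot_dotGradient (ψ : Pt d → ℝ) (x a : Pt d) :
    fderiv ℝ ψ x a = dot a (dotGradient ψ x) := by
  have ha : a = ∑ i : Fin d, a.1 i • dirT i + a.2 • dirZ := by
    refine Prod.ext ?_ ?_
    · ext j
      simp [dirT, dirZ, Prod.fst_sum, Finset.sum_apply, Pi.single_apply]
    · simp [dirT, dirZ, Prod.snd_sum]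
  conv_lhs => rw [ha]
  simp only [map_add, map_sum, map_smul]
  simp [dotGradient, dot, dirT, dirZ, Prod.fst_sum, Prod.snd_sum, inner_sum, inner_smul_right,
    EuclideanSpace.inner_single_right, mul_comm]

theorem continuous_dotGradient {ψ : Pt d → ℝ} (hψ : ContDiff ℝ ∞ ψ) :
    Continuous (dotGradient ψ) := by
  have h := hψ.continuous_fderiv (by simp)
  unfold dotGradient
  fun_prop

/-- Weak convergence in `H_div(Ω₁)` passes to the limit in Green's formula. -/
theorem tendsto_green {g : Geometry d} {u : ℕ → HdivField g.Ω₁} {l : HdivField g.Ω₁}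
    (hu : WeakHdiv u l) {ψ : Pt d → ℝ} (hψ : ContDiff ℝ ∞ ψ) :
    Tendsto (fun k => ∫ x in g.Ω₁, (fderiv ℝ ψ x ((u k).val x) + (u k).div x * ψ x)) atTop
      (𝓝 (∫ x in g.Ω₁, (fderiv ℝ ψ x (l.val x) + l.div x * ψ x))) := by
  have hψ2 : IsL2 g.Ω₁ ψ := g.isL2_Ω₁_of_continuous hψ.continuous
  have hD : IsL2 g.Ω₁ (dotGradient ψ) := g.isL2_Ω₁_of_continuous (continuous_dotGradient hψ)
  have hsplit : ∀ w : HdivField g.Ω₁,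
      ∫ x in g.Ω₁, (fderiv ℝ ψ x (w.val x) + w.div x * ψ x) =
        (∫ x in g.Ω₁, dot (w.val x) (dotGradient ψ x)) + ∫ x in g.Ω₁, w.div x * ψ x := by
    intro w
    simp only [fderiv_eq_dot_dotGradient]
    exact integral_add (IsL2.integrable_dot w.val_mem hD) (w.div_mem.integrable_mul hψ2)
  simp only [hsplit]
  exact (hu.1 _ hD).add (hu.2 _ hψ2)

/-- The limit divergence: the mass balance in `Ω₁` is linear, hence stable under weak limits. -/
theorem ae_div_eq_of_weak_limit {g : Geometry d} {ε : ℕ → ℝ} {h : ℕ → Pt d → ℝ} {h₁ : Pt d → ℝ}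
    (hh₁ : IsL2 g.Ω₁ h₁) (hh : WeakL2 g.Ω₁ h h₁) {v : ℕ → g.X}
    (hv : ∀ k, ∀ φ : g.Y, g.MassBalance (ε k) (h k) (v k) φ) {v₁ : HdivField g.Ω₁}
    (hv₁ : WeakHdiv (fun k => (v k).one) v₁) :
    ∀ᵐ x ∂volume.restrict g.Ω₁, v₁.div x = h₁ x := by
  have hdiff : IsL2 g.Ω₁ (fun x => v₁.div x - h₁ x) := v₁.div_mem.sub hh₁
  have heq : ∫ x in g.Ω₁, v₁.div x * (v₁.div x - h₁ x) =
      ∫ x in g.Ω₁, h₁ x * (v₁.div x - h₁ x) := by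
    refine tendsto_nhds_unique (hv₁.2 _ hdiff) ((hh _ hdiff).congr fun k => ?_)
    have := hv k ⟨_, 0, hdiff, MemLp.zero'⟩
    simp only [MassBalance, Pi.zero_apply, mul_zero, integral_zero, add_zero] at this
    exact this.symm
  have hsq : ∫ x in g.Ω₁, (v₁.div x - h₁ x) ^ 2 = 0 := by
    have i1 : Integrable (fun x => v₁.div x * (v₁.div x - h₁ x)) (volume.restrict g.Ω₁) :=
      v₁.div_mem.integrable_mul hdiff
    have i2 : Integrable (fun x => h₁ x * (v₁.div x - h₁ x)) (volume.restrict g.Ω₁) :=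
      hh₁.integrable_mul hdiff
    rw [← sub_eq_zero.2 heq, ← integral_sub i1 i2]
    exact integral_congr_ae (ae_of_all _ fun x => by ring)
  have h0 := (integral_eq_zero_iff_of_nonneg (fun x => sq_nonneg _) hdiff.integrable_sq).1 hsq
  filter_upwards [h0] with x hx
  exact sub_eq_zero.1 (pow_eq_zero_iff two_ne_zero |>.1 hx)

/-- The normal trace of the limit is the column integral of `∇_T · v²` divided by the area density:
the fluxes of `v^ε` converge weakly to it, and Green's formula in `Ω₁` is stable under weak
limits. -/
theorem exists_hasNormalTrace_of_weak_limit {g : Geometry d} {ε : ℕ → ℝ} (hε_pos : ∀ k, 0 < ε k)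
    (hε : Tendsto ε atTop (𝓝 0)) {h : ℕ → Pt d → ℝ} {v : ℕ → g.X}
    (hv : ∀ k, ∀ φ : g.Y, g.MassBalance (ε k) (h k) (v k) φ)
    {v₁ : HdivField g.Ω₁} (hv₁ : WeakHdiv (fun k => (v k).one) v₁)
    {χ : Pt d → Pt d} (hχ : WeakL2Vec g.Ω₂ (fun k => (v k).two.dz) χ)
    {v₂ : H1Field g.Ω₂} (hv₂ : WeakH1Scaled ε (fun k => (v k).two.toH1Field) v₂) :
    ∃ q : Hor d → ℝ, g.HasNormalTrace v₁ q ∧ ∀ φ : Hor d → ℝ, IsL2 g.G φ →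
      g.surfaceIntegral (fun x => q x * φ x) = ∫ y in g.Ω₂, v₂.divT y * φ y.1 := by
  have hdivT : IsL2 g.Ω₂ v₂.divT := g.memLp_divT v₂
  have hmean := memLp_two_columnMean g.measurableSet_G g.continuousOn_ζ hdivT
  let q : Hor d → ℝ := fun x => (g.area x)⁻¹ * columnMean g.G g.ζ v₂.divT x
  have hq : IsL2 g.G q := by
    refine hmean.of_le (g.measurable_area.inv.aestronglyMeasurable.mul hmean.1)
      (ae_of_all _ fun x => ?_)
    have h1 := g.one_le_area x
    rw [norm_mul, norm_inv, Real.norm_of_nonneg (zero_le_one.trans h1)]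
    exact mul_le_of_le_one_left (norm_nonneg _) (inv_le_one_of_one_le₀ h1)
  have hqφ : ∀ φ : Hor d → ℝ, IsL2 g.G φ →
      g.surfaceIntegral (fun x => q x * φ x) = ∫ y in g.Ω₂, v₂.divT y * φ y.1 := by
    intro φ hφ
    have hint : Integrable (fun y : Pt d => φ y.1 • v₂.divT y) (volume.restrict g.Ω₂) :=
      (g.memLp_comp_fst hφ).integrable_mul hdivT
    have e := integral_cylinderOver g.measurableSet_G g.continuousOn_ζ hint
    simp only [columnMean_smul] at e
    simp only [mul_comm (v₂.divT _)]
    refine Eq.trans (integral_congr_ae (ae_of_all _ fun x => ?_)) e.symm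
    have h1 : g.area x ≠ 0 := (zero_lt_one.trans_le (g.one_le_area x)).ne'
    simp only [q, smul_eq_mul]
    field_simp
  refine ⟨q, ⟨hq, fun ψ hψ hsupp => ?_⟩, hqφ⟩
  obtain ⟨C, hC⟩ := hψ.2.exists_bound_of_continuous hψ.1.continuous
  -- The restriction of `ψ` to `Γ` is bounded, so it may serve as a weight for the fluxes.
  have hm : AEStronglyMeasurable (fun x => ψ (x, g.ζ x)) (volume.restrict g.G) :=
    (hψ.1.continuous.comp_continuousOn
      (continuousOn_id.prodMk g.continuousOn_ζ)).aestronglyMeasurable g.measurableSet_G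
  have hφ : IsL2 g.G (fun x => ψ (x, g.ζ x)) := MemLp.of_bound hm C (ae_of_all _ fun x => hC _)
  have hlim := tendsto_surfaceIntegral_normalTrace hε_pos hε hv hχ hv₂ hφ
  rw [← hqφ _ hφ] at hlim
  refine tendsto_nhds_unique (tendsto_green hv₁ hψ.1) (hlim.congr fun k => ?_)
  exact ((v k).matching.2 ψ hψ hsupp).symm

end Geometry

end DarcyStokes

theorem mainTheorem9 {d : ℕ} (g : DarcyStokes.Geometry d) (c : DarcyStokes.Coefficients g)
    -- the parameters `ε k ↓ 0` of the subsequence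
    (ε : ℕ → ℝ) (hε_pos : ∀ k, 0 < ε k) (hε : Tendsto ε atTop (𝓝 0))
    -- weakly convergent forcing terms
    (f : ℕ → DarcyStokes.Pt d → DarcyStokes.Pt d) (f₂ : DarcyStokes.Pt d → DarcyStokes.Pt d)
    (hf : ∀ k, DarcyStokes.IsL2 g.Ω₂ (f k)) (hf₂ : DarcyStokes.IsL2 g.Ω₂ f₂)
    (hf_lim : DarcyStokes.WeakL2Vec g.Ω₂ f f₂)
    (h : ℕ → DarcyStokes.Pt d → ℝ) (h₁ : DarcyStokes.Pt d → ℝ)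
    (hh : ∀ k, DarcyStokes.IsL2 g.Ω₁ (h k)) (hh₁ : DarcyStokes.IsL2 g.Ω₁ h₁)
    (hh_lim : DarcyStokes.WeakL2 g.Ω₁ h h₁)
    -- the solutions
    (v : ℕ → g.X) (p : ℕ → g.Y) (hsol : ∀ k, g.IsSolution c (ε k) (f k) (h k) (v k) (p k))
    -- the limits of the velocities
    (v₁ : DarcyStokes.HdivField g.Ω₁)
    (hv₁ : DarcyStokes.WeakHdiv (fun k => (v k).one) v₁)
    (χ : DarcyStokes.Pt d → DarcyStokes.Pt d) (hχ : DarcyStokes.IsL2 g.Ω₂ χ)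
    (hχ_lim : DarcyStokes.WeakL2Vec g.Ω₂ (fun k => (v k).two.dz) χ)
    (v₂ : DarcyStokes.H1Field g.Ω₂)
    (hv₂ : DarcyStokes.WeakH1Scaled ε (fun k => (v k).two.toH1Field) v₂) :
    -- `∇ · v¹ = h¹` in `Ω₁`
    (∀ᵐ x ∂(volume.restrict g.Ω₁), v₁.div x = h₁ x) ∧
    -- `v¹ · n` on `Γ` is a function `q ∈ L²(Γ)`, and the interface mass balance holds
    ∃ q : DarcyStokes.Hor d → ℝ, g.HasNormalTrace v₁ q ∧
      ∀ φ : DarcyStokes.Hor d → ℝ, DarcyStokes.IsL2 g.G φ →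
        (∫ x in g.Ω₂, v₂.divT x * φ x.1) - (∫ x in g.G, g.area x * (q x * φ x)) = 0 := by
  have hmass : ∀ k, ∀ φ : g.Y, g.MassBalance (ε k) (h k) (v k) φ := fun k => (hsol k).2
  refine ⟨DarcyStokes.Geometry.ae_div_eq_of_weak_limit hh₁ hh_lim hmass hv₁, ?_⟩
  obtain ⟨q, hq, hqφ⟩ := DarcyStokes.Geometry.exists_hasNormalTrace_of_weak_limit hε_pos hε hmass
    hv₁ hχ_lim hv₂
  refine ⟨q, hq, fun φ hφ => ?_⟩
  rw [← hqφ φ hφ, sub_eq_zero]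
  exact integral_congr_ae (ae_of_all _ fun x => by ring)
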